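/- Let $n\ge 1$ and $0<\eta<1$. A cube in $\mathbb R^n$ is a product of $n$ bounded intervals of equal positive length (its side length), each with or without its endpoints. A dyadic grid $\mathcal D$ in $\mathbb R^n$ is a collection of cubes such that (i) every $Q\in\mathcal D$ has side length $2^k$ for some $k\in\mathbb Z$; (ii) any two cubes of $\mathcal D$ are disjoint or one contains the other; (iii) for every $k\in\mathbb Z$ and $x\in\mathbb R^n$ exactly one cube of $\mathcal D$ of side length $2^k$ contains $x$. A family $\mathcal S\subset\mathcal D$ is $\eta$-sparse if there are pairwise disjoint measurable sets $E_Q\subset Q$, $Q\in\mathcal S$, with $|E_Q|\ge\eta|Q|$. The sparse operator of $\mathcal S$ is $$\mathcal A_{\mathcal S}f(x)=\sum_{Q\in\mathcal S}\Big(\frac1{|Q|}\int_Q f(y)\,dy\Big)\chi_Q(x).$$ For a measurable function $f$ on $\mathbb R^n$ let $f^*(t)=\inf\{s>0:|\{|f|>s\}|\le t\}\in[0,\infty]$, $t>0$, be its decreasing rearrangement, and for $1\le p<\infty$ put $$\|f\|_{L^{p,1}}=\frac1p\int_0^\infty s^{1/p-1}f^*(s)\,ds,\qquad \|f\|_{L^{p,\infty}}=\sup_{t>0}t^{1/p}f^*(t).$$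 **Statement.** There is a constant $C>0$, depending only on $n$ and $\eta$, such that for every dyadic grid $\mathcal D$, every $\eta$-sparse family $\mathcal S\subset\mathcal D$ and every measurable (real or complex valued) function $f$ on $\mathbb R^n$ the following hold. (a) For every $t>0$, $$(\mathcal A_{\mathcal S}f)^*(t)\le C\left(\frac1t\int_0^t f^*(s)\,ds+\int_t^\infty f^*(s)\,\frac{ds}s\right).$$ Here the right-hand side may be $+\infty$, in which case there is nothing to prove. If it is finite for some $t>0$, then $\mathcal A_{\mathcal S}f$ is well defined: $f$ is integrable on every $Q\in\mathcal S$, and the series defining $\mathcal A_{\mathcal S}f(x)$ converges absolutely for almost every $x$. (b) For every $1\le p<\infty$, $\ \|\mathcal A_{\mathcal S}f\|_{L^{p,\infty}}\le C\,p\,\|f\|_{L^{p,1}}$ (if the right-hand side is infinite there is nothing to prove). -/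

import Mathlib

open MeasureTheory
open scoped ENNReal

noncomputable section

namespace SparseOp

/-- `Q` is a cube in `ℝⁿ` with sides parallel to the axes and side length `ℓ > 0`: a product of
bounded intervals of length `ℓ`, each of which may or may not contain its endpoints. -/
def IsCube {n : ℕ} (ℓ : ℝ) (Q : Set (Fin n → ℝ)) : Prop :=
  0 < ℓ ∧ ∃ (a : Fin n → ℝ) (I : Fin n → Set ℝ),
    (∀ i, Set.Ioo (a i) (a i + ℓ) ⊆ I i ∧ I i ⊆ Set.Icc (a i) (a i + ℓ)) ∧
    Q = Set.univ.pi I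

/-- A general dyadic grid in `ℝⁿ`. -/
structure IsDyadicGrid {n : ℕ} (D : Set (Set (Fin n → ℝ))) : Prop where
  /-- Every member is a cube of side length `2 ^ k` for some integer `k`. -/
  side : ∀ Q ∈ D, ∃ k : ℤ, IsCube ((2 : ℝ) ^ k) Q
  /-- Two members are disjoint or one is contained in the other. -/
  nested : ∀ Q ∈ D, ∀ R ∈ D, Disjoint Q R ∨ Q ⊆ R ∨ R ⊆ Q
  /-- Every point lies in exactly one member of each side length `2 ^ k`. -/
  cover : ∀ (k : ℤ) (x : Fin n → ℝ), ∃! Q, Q ∈ D ∧ IsCube ((2 : ℝ) ^ k) Q ∧ x ∈ Q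

/-- A family of cubes is `η`-sparse if there are pairwise disjoint measurable sets `E Q ⊆ Q` with
`|E Q| ≥ η |Q|`. -/
def IsSparse {n : ℕ} (η : ℝ) (S : Set (Set (Fin n → ℝ))) : Prop :=
  ∃ E : Set (Fin n → ℝ) → Set (Fin n → ℝ),
    (∀ Q ∈ S, MeasurableSet (E Q) ∧ E Q ⊆ Q ∧
      ENNReal.ofReal η * volume Q ≤ volume (E Q)) ∧
    S.PairwiseDisjoint E

/-- The term `(|Q|⁻¹ ∫_Q f) χ_Q(x)` of the sparse operator. -/
def sparseTerm {n : ℕ} {𝕜 : Type*} [RCLike 𝕜] (f : (Fin n → ℝ) → 𝕜)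
    (Q : Set (Fin n → ℝ)) (x : Fin n → ℝ) : 𝕜 :=
  Q.indicator (fun _ => ⨍ y in Q, f y) x

/-- The sparse operator `A_S f (x) = ∑_{Q ∈ S} (|Q|⁻¹ ∫_Q f) χ_Q(x)`. -/
def sparseOperator {n : ℕ} {𝕜 : Type*} [RCLike 𝕜] (S : Set (Set (Fin n → ℝ)))
    (f : (Fin n → ℝ) → 𝕜) (x : Fin n → ℝ) : 𝕜 :=
  ∑' Q : S, sparseTerm f Q x

/-- The decreasing rearrangement `f^*(t) = inf {s : |{|f| > s}| ≤ t}` with respect to Lebesgue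
measure, with values in `[0, ∞]` (it is `∞` when no finite `s` qualifies). -/
def rearrangement {n : ℕ} {𝕜 : Type*} [RCLike 𝕜] (f : (Fin n → ℝ) → 𝕜) (t : ℝ) : ℝ≥0∞ :=
  sInf {s : ℝ≥0∞ | volume {x | s < ‖f x‖ₑ} ≤ ENNReal.ofReal t}

/-- The Calderón operator `(1/t) ∫_0^t g(s) ds + ∫_t^∞ g(s) ds/s`, with values in `[0, ∞]`. -/
def calderon (g : ℝ → ℝ≥0∞) (t : ℝ) : ℝ≥0∞ :=
  (∫⁻ s in Set.Ioc 0 t, g s) / ENNReal.ofReal t + ∫⁻ s in Set.Ioi t, g s / ENNReal.ofReal s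

/-- The Lorentz `L^{p,1}` norm `(1/p) ∫_0^∞ s^{1/p - 1} f^*(s) ds`, normalized so that the
indicator function of a set `E` has norm `|E|^{1/p}`. -/
def lorentzOneNorm {n : ℕ} {𝕜 : Type*} [RCLike 𝕜] (p : ℝ) (f : (Fin n → ℝ) → 𝕜) : ℝ≥0∞ :=
  ENNReal.ofReal (1 / p) *
    ∫⁻ s in Set.Ioi (0 : ℝ), ENNReal.ofReal (s ^ (1 / p - 1)) * rearrangement f s

/-- The weak Lorentz quasi-norm of `L^{p,∞}`: `sup_{t > 0} t^{1/p} f^*(t)`. -/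
def weakNorm {n : ℕ} {𝕜 : Type*} [RCLike 𝕜] (p : ℝ) (f : (Fin n → ℝ) → 𝕜) : ℝ≥0∞ :=
  ⨆ (t : ℝ) (_ : 0 < t), ENNReal.ofReal (t ^ (1 / p)) * rearrangement f t

end SparseOp

end

/-! Write T for the Calderón operator and M for the maximal operator over the cubes of the family.
It suffices to treat nonnegative φ and finite families: |f| dominates f, and level sets of an
infinite positive sum are increasing unions of those of its finite subsums.

Nestedness gives a·|{Mφ > a}| ≤ ∫_{Mφ > a} φ, hence (Mφ)*(s) is at most the average of φ* over (0,
s). Sparseness replaces |Q| by |E_Q|/η with the E_Q disjoint, so for any set F the integral of the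
sparse operator over F is at most η⁻¹ ∫ Mφ · M(1_F).

Let F be a level set {A_S φ > l}, τ = |F| and A = Tφ*(τ). By Hardy-Littlewood the last integral is
controlled by rearrangements, but (Mφ)* may be too large on (0, τ). So the set {Mφ > 2A}, of measure
at most τ/2, is removed from F. On what remains only cubes of average at most 2A act, and Mφ may be
truncated at 2A. Then (0, τ) contributes at most 2Aτ and the tail at most Aτ, so η·l·τ/2 ≤ 3Aτ, that
is l ≤ (6/η)A. The core is `setLIntegral_familySparse_le` and `lintegral_min_familyMaximal_mul_le`,
combined in `IsNestedFamily.decRearr_familySparse_le`.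

The Lorentz bound follows by comparing the kernel 1/max(s, t) of T with the weight s^(1/p - 1). -/

namespace SparseOp

/-! ### Decreasing rearrangements and the Hardy-Littlewood inequality -/

variable {X : Type*} [MeasurableSpace X] {μ : Measure X}

/-- The decreasing rearrangement of a `[0, ∞]`-valued function on a measure space. -/
noncomputable def decRearr (μ : Measure X) (φ : X → ℝ≥0∞) (t : ℝ) : ℝ≥0∞ :=
  sInf {s : ℝ≥0∞ | μ {x | s < φ x} ≤ ENNReal.ofReal t}

/-- The distribution function is right-continuous, by continuity of measure along increasing unions,
so the infimum is attained. All later facts on rearrangements pass through this equivalence. -/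
theorem lt_decRearr_iff {φ : X → ℝ≥0∞} {t : ℝ} {a : ℝ≥0∞} :
    a < decRearr μ φ t ↔ ENNReal.ofReal t < μ {x | a < φ x} := by
  constructor
  · intro h
    by_contra! h'
    exact absurd (sInf_le (show a ∈ {s : ℝ≥0∞ | μ {x | s < φ x} ≤ ENNReal.ofReal t} from h'))
      (not_le.2 h)
  · intro h
    by_contra! h'
    rcases eq_or_ne a ∞ with rfl | ha
    · simp at h
    obtain ⟨u, hu, hua, hul⟩ := exists_seq_strictAnti_tendsto' (lt_top_iff_ne_top.2 ha)
    have hset : {x | a < φ x} = ⋃ n, {x | u n < φ x} := by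
      ext x
      simp only [Set.mem_ofPred_eq, Set.mem_iUnion]
      constructor
      · intro hx
        exact ((tendsto_order.1 hul).2 _ hx).exists
      · rintro ⟨n, hn⟩
        exact (hua n).1.trans hn
    have hmono : Monotone fun n => {x | u n < φ x} := fun m n hmn x hx =>
      (hu.antitone hmn).trans_lt hx
    rw [hset, hmono.measure_iUnion] at h
    obtain ⟨n, hn⟩ := lt_iSup_iff.1 h
    obtain ⟨s, hs, hsn⟩ := sInf_lt_iff.1 (h'.trans_lt (hua n).1)
    exact absurd (hn.trans_le (measure_mono fun x hx => hsn.trans hx)) (not_lt.2 hs)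

theorem decRearr_antitone (μ : Measure X) (φ : X → ℝ≥0∞) : Antitone (decRearr μ φ) := by
  intro s t hst
  refine le_of_forall_lt fun a ha => ?_
  rw [lt_decRearr_iff] at ha ⊢
  exact (ENNReal.ofReal_le_ofReal hst).trans_lt ha

theorem measurable_decRearr (μ : Measure X) (φ : X → ℝ≥0∞) : Measurable (decRearr μ φ) :=
  (decRearr_antitone μ φ).measurable

theorem decRearr_mono {φ ψ : X → ℝ≥0∞} (h : ∀ x, φ x ≤ ψ x) (t : ℝ) :
    decRearr μ φ t ≤ decRearr μ ψ t := by
  refine le_of_forall_lt fun a ha => ?_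
  rw [lt_decRearr_iff] at ha ⊢
  exact ha.trans_le (measure_mono fun x hx => lt_of_lt_of_le hx (h x))

theorem decRearr_congr_ae {φ ψ : X → ℝ≥0∞} (h : φ =ᵐ[μ] ψ) (t : ℝ) :
    decRearr μ φ t = decRearr μ ψ t := by
  refine eq_of_forall_lt_iff fun a => ?_
  rw [lt_decRearr_iff, lt_decRearr_iff, measure_congr (Filter.eventuallyEq_set.2 ?_)]
  filter_upwards [h] with x hx
  simp [hx]

theorem decRearr_le_of_le {φ : X → ℝ≥0∞} {c : ℝ≥0∞} (h : ∀ x, φ x ≤ c) (t : ℝ) :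
    decRearr μ φ t ≤ c := by
  refine sInf_le ?_
  have : {x | c < φ x} = ∅ := by
    ext x
    simpa using h x
  simp [this]

theorem volume_ofReal_lt (c : ℝ≥0∞) :
    volume (Set.Ioi (0 : ℝ) ∩ {a | ENNReal.ofReal a < c}) = c := by
  rcases eq_or_ne c ∞ with rfl | hc
  · simp
  · lift c to NNReal using hc
    have : Set.Ioi (0 : ℝ) ∩ {a | ENNReal.ofReal a < c} = Set.Ioo 0 (c : ℝ) := by
      ext a
      simp only [Set.mem_inter_iff, Set.mem_Ioi, Set.mem_ofPred_eq, Set.mem_Ioo]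
      refine and_congr_right fun ha => ?_
      rw [← ENNReal.ofReal_coe_nnreal, ENNReal.ofReal_lt_ofReal_iff_of_nonneg ha.le]
    rw [this, Real.volume_Ioo, sub_zero, ENNReal.ofReal_coe_nnreal]

/-- Layer-cake formula for the product of two functions. -/
theorem lintegral_mul_eq_lintegral_meas [SFinite μ] {u v : X → ℝ≥0∞} (hu : Measurable u)
    (hv : Measurable v) :
    ∫⁻ x, u x * v x ∂μ = ∫⁻ a in Set.Ioi (0 : ℝ), ∫⁻ b in Set.Ioi (0 : ℝ),
      μ ({x | ENNReal.ofReal a < u x} ∩ {x | ENNReal.ofReal b < v x}) := by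
  have layer : ∀ c : ℝ≥0∞, c = ∫⁻ a in Set.Ioi (0 : ℝ),
      {a : ℝ | ENNReal.ofReal a < c}.indicator 1 a := by
    intro c
    rw [lintegral_indicator_one (measurableSet_lt (by fun_prop) measurable_const),
      Measure.restrict_apply (measurableSet_lt (by fun_prop) measurable_const), Set.inter_comm,
      volume_ofReal_lt]
  have hmeas : ∀ {w : X → ℝ≥0∞}, Measurable w → Measurable fun p : X × ℝ =>
      {a : ℝ | ENNReal.ofReal a < w p.1}.indicator (1 : ℝ → ℝ≥0∞) p.2 := by
    intro w hw
    exact (measurable_const (a := (1 : ℝ≥0∞))).indicator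
      (s := {p : X × ℝ | ENNReal.ofReal p.2 < w p.1}) (measurableSet_lt (by fun_prop) (by fun_prop))
  have hsec : ∀ c : ℝ≥0∞, Measurable fun a : ℝ =>
      {a : ℝ | ENNReal.ofReal a < c}.indicator (1 : ℝ → ℝ≥0∞) a := fun c =>
    measurable_one.indicator (measurableSet_lt (by fun_prop) measurable_const)
  calc ∫⁻ x, u x * v x ∂μ
      = ∫⁻ x, (∫⁻ a in Set.Ioi (0 : ℝ),
          {a : ℝ | ENNReal.ofReal a < u x}.indicator 1 a * v x) ∂μ := by
        refine lintegral_congr fun x => ?_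
        rw [lintegral_mul_const _ (hsec _), ← layer]
    _ = ∫⁻ a in Set.Ioi (0 : ℝ), ∫⁻ x,
          {a : ℝ | ENNReal.ofReal a < u x}.indicator 1 a * v x ∂μ :=
        lintegral_lintegral_swap ((hmeas hu).mul (hv.comp measurable_fst)).aemeasurable
    _ = ∫⁻ a in Set.Ioi (0 : ℝ), ∫⁻ x, (∫⁻ b in Set.Ioi (0 : ℝ),
          {a : ℝ | ENNReal.ofReal a < u x}.indicator 1 a *
            {b : ℝ | ENNReal.ofReal b < v x}.indicator 1 b) ∂μ := by
        refine lintegral_congr fun a => lintegral_congr fun x => ?_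
        rw [lintegral_const_mul _ (hsec _), ← layer]
    _ = ∫⁻ a in Set.Ioi (0 : ℝ), ∫⁻ b in Set.Ioi (0 : ℝ), ∫⁻ x,
          {a : ℝ | ENNReal.ofReal a < u x}.indicator 1 a *
            {b : ℝ | ENNReal.ofReal b < v x}.indicator 1 b ∂μ := by
        refine lintegral_congr fun a => lintegral_lintegral_swap (Measurable.aemeasurable ?_)
        have h1 : Measurable fun x : X =>
            {a : ℝ | ENNReal.ofReal a < u x}.indicator (1 : ℝ → ℝ≥0∞) a :=
          (hmeas hu).comp (measurable_id.prodMk measurable_const)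
        exact (h1.comp measurable_fst).mul (hmeas hv)
    _ = _ := by
        refine lintegral_congr fun a => lintegral_congr fun b => ?_
        rw [← lintegral_indicator_one ((measurableSet_lt measurable_const hu).inter
          (measurableSet_lt measurable_const hv))]
        refine lintegral_congr fun x => ?_
        by_cases h1 : ENNReal.ofReal a < u x <;> by_cases h2 : ENNReal.ofReal b < v x <;>
          simp [h1, h2, Set.indicator]

/-- The Hardy-Littlewood rearrangement inequality. -/
theorem lintegral_mul_le_lintegral_decRearr [SFinite μ] {u v : X → ℝ≥0∞} (hu : Measurable u)
    (hv : Measurable v) :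
    ∫⁻ x, u x * v x ∂μ ≤ ∫⁻ s in Set.Ioi (0 : ℝ), decRearr μ u s * decRearr μ v s := by
  rw [lintegral_mul_eq_lintegral_meas hu hv,
    lintegral_mul_eq_lintegral_meas (measurable_decRearr μ u) (measurable_decRearr μ v)]
  refine lintegral_mono fun a => lintegral_mono fun b => ?_
  -- Superlevel sets of the rearrangements are nested initial intervals, so their intersection has
  -- exactly the smaller of the two measures, which bounds the measure of the intersection in `X`.
  have hset : {s | ENNReal.ofReal a < decRearr μ u s} ∩ {s | ENNReal.ofReal b < decRearr μ v s} =
      {s | ENNReal.ofReal s < min (μ {x | ENNReal.ofReal a < u x})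
        (μ {x | ENNReal.ofReal b < v x})} := by
    ext s
    simp [lt_decRearr_iff]
  rw [hset, Measure.restrict_apply (measurableSet_lt (by fun_prop) measurable_const),
    Set.inter_comm _ (Set.Ioi 0), volume_ofReal_lt]
  exact le_min (measure_mono Set.inter_subset_left) (measure_mono Set.inter_subset_right)

/-- The integral over a set is at most that of the rearrangement over an interval. -/
theorem setLIntegral_le_lintegral_decRearr [SFinite μ] {φ : X → ℝ≥0∞} (hφ : Measurable φ)
    {G : Set X} (hG : MeasurableSet G) {m : ℝ} (hm : μ G ≤ ENNReal.ofReal m) :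
    ∫⁻ x in G, φ x ∂μ ≤ ∫⁻ s in Set.Ioc 0 m, decRearr μ φ s := by
  have h := lintegral_mul_le_lintegral_decRearr (μ := μ) hφ
    ((measurable_const (a := (1 : ℝ≥0∞))).indicator hG)
  rw [← lintegral_indicator hG]
  calc ∫⁻ x, G.indicator φ x ∂μ = ∫⁻ x, φ x * G.indicator (fun _ => 1) x ∂μ := by
        refine lintegral_congr fun x => ?_
        by_cases hx : x ∈ G <;> simp [hx]
    _ ≤ _ := h
    _ ≤ ∫⁻ s in Set.Ioi (0 : ℝ), (Set.Ioc 0 m).indicator (decRearr μ φ) s := by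
        refine setLIntegral_mono' measurableSet_Ioi fun s hs => ?_
        by_cases hsm : s ≤ m
        · rw [Set.indicator_of_mem (show s ∈ Set.Ioc 0 m from ⟨hs, hsm⟩)]
          refine mul_le_of_le_one_right' (decRearr_le_of_le (fun x => ?_) s)
          exact Set.indicator_le_self' (by simp) x
        · have : decRearr μ (G.indicator fun _ => (1 : ℝ≥0∞)) s = 0 := by
            refine le_antisymm (sInf_le ?_) zero_le
            have hsub : {x | 0 < G.indicator (fun _ => (1 : ℝ≥0∞)) x} ⊆ G := by
              intro x hx
              by_contra hxG
              simp [hxG] at hx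
            exact (measure_mono hsub).trans
              (hm.trans (ENNReal.ofReal_le_ofReal (not_le.1 hsm).le))
          simp [this]
    _ ≤ ∫⁻ s, (Set.Ioc 0 m).indicator (decRearr μ φ) s := setLIntegral_le_lintegral _ _
    _ = _ := lintegral_indicator measurableSet_Ioc _

/-! ### The Calderón operator -/

/-- With the single kernel 1/max(s, t), comparisons of Calderón integrals become pointwise
comparisons of kernels. -/
theorem calderon_eq_lintegral_max {g : ℝ → ℝ≥0∞} (hg : Measurable g) {t : ℝ} (ht : 0 < t) :
    calderon g t = ∫⁻ s in Set.Ioi (0 : ℝ), g s * (ENNReal.ofReal (max s t))⁻¹ := by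
  rw [← Set.Ioc_union_Ioi_eq_Ioi ht.le, lintegral_union measurableSet_Ioi Set.Ioc_disjoint_Ioi_same,
    calderon, div_eq_mul_inv, ← lintegral_mul_const _ hg]
  congr 1
  · refine setLIntegral_congr_fun measurableSet_Ioc fun s hs => ?_
    simp only [max_eq_right hs.2]
  · refine setLIntegral_congr_fun measurableSet_Ioi fun s hs => ?_
    have hs' : t < s := hs
    simp only [max_eq_left hs'.le, div_eq_mul_inv]

theorem calderon_anti {g : ℝ → ℝ≥0∞} (hg : Measurable g) {t u : ℝ} (ht : 0 < t) (htu : t ≤ u) :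
    calderon g u ≤ calderon g t := by
  rw [calderon_eq_lintegral_max hg ht, calderon_eq_lintegral_max hg (ht.trans_le htu)]
  gcongr

theorem lintegral_Ioi_inv_sq {m : ℝ} (hm : 0 < m) :
    ∫⁻ s in Set.Ioi m, (ENNReal.ofReal s)⁻¹ * (ENNReal.ofReal s)⁻¹ = (ENNReal.ofReal m)⁻¹ := by
  have h := ofReal_integral_eq_lintegral_ofReal
    (integrableOn_Ioi_rpow_of_lt (a := -2) (by norm_num) hm)
    ((ae_restrict_mem measurableSet_Ioi).mono fun s hs =>
      Real.rpow_nonneg (hm.trans hs).le _)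
  rw [integral_Ioi_rpow_of_lt (by norm_num) hm] at h
  have h1 : -m ^ ((-2 : ℝ) + 1) / (-2 + 1) = m⁻¹ := by
    rw [show (-2 : ℝ) + 1 = -1 by norm_num, Real.rpow_neg_one]
    ring
  rw [h1, ENNReal.ofReal_inv_of_pos hm] at h
  rw [h]
  refine setLIntegral_congr_fun measurableSet_Ioi fun s hs => ?_
  have hs0 : 0 < s := hm.trans hs
  rw [← ENNReal.ofReal_inv_of_pos hs0, ← ENNReal.ofReal_mul (by positivity), Real.rpow_neg hs0.le,
    Real.rpow_two, sq, mul_inv]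

/-- The tail integral of the averages of `g` is the Calderón operator of `g`. -/
theorem lintegral_Ioi_average_div {g : ℝ → ℝ≥0∞} (hg : Measurable g) {t : ℝ} (ht : 0 < t) :
    ∫⁻ s in Set.Ioi t, (∫⁻ r in Set.Ioc 0 s, g r) / ENNReal.ofReal s / ENNReal.ofReal s =
      calderon g t := by
  have hK : Measurable fun p : ℝ × ℝ => {p : ℝ × ℝ | p.2 ≤ p.1}.indicator
      (fun p => g p.2 * ((ENNReal.ofReal p.1)⁻¹ * (ENNReal.ofReal p.1)⁻¹)) p :=
    Measurable.indicator (by fun_prop) (measurableSet_le (by fun_prop) (by fun_prop))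
  calc ∫⁻ s in Set.Ioi t, (∫⁻ r in Set.Ioc 0 s, g r) / ENNReal.ofReal s / ENNReal.ofReal s
      = ∫⁻ s in Set.Ioi t, ∫⁻ r in Set.Ioi (0 : ℝ), {p : ℝ × ℝ | p.2 ≤ p.1}.indicator
          (fun p => g p.2 * ((ENNReal.ofReal p.1)⁻¹ * (ENNReal.ofReal p.1)⁻¹)) (s, r) := by
        refine lintegral_congr fun s => ?_
        rw [div_eq_mul_inv, div_eq_mul_inv, mul_assoc, ← lintegral_mul_const _ hg,
          ← lintegral_indicator measurableSet_Ioc, ← lintegral_indicator measurableSet_Ioi]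
        refine lintegral_congr fun r => ?_
        by_cases h1 : 0 < r <;> by_cases h2 : r ≤ s <;> simp [Set.indicator, h1, h2]
    -- Tonelli: for fixed r the variable s runs over s > t with s ≥ r, and ds/s² integrates there to
    -- 1/max(r, t).
    _ = ∫⁻ r in Set.Ioi (0 : ℝ), ∫⁻ s in Set.Ioi t, {p : ℝ × ℝ | p.2 ≤ p.1}.indicator
          (fun p => g p.2 * ((ENNReal.ofReal p.1)⁻¹ * (ENNReal.ofReal p.1)⁻¹)) (s, r) :=
        lintegral_lintegral_swap hK.aemeasurable
    _ = ∫⁻ r in Set.Ioi (0 : ℝ), g r * (ENNReal.ofReal (max r t))⁻¹ := by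
        refine setLIntegral_congr_fun measurableSet_Ioi fun r hr => ?_
        have hmax : 0 < max r t := lt_max_of_lt_right ht
        rw [← lintegral_Ioi_inv_sq hmax, ← lintegral_const_mul _ (by fun_prop),
          ← setLIntegral_congr (Ioi_ae_eq_Ici (a := max r t)).symm,
          ← lintegral_indicator measurableSet_Ioi, ← lintegral_indicator measurableSet_Ici]
        refine lintegral_congr_ae ?_
        -- When r ≤ t the two ranges of s differ only by the point t.
        filter_upwards [Measure.ae_ne volume t] with s hs
        rcases lt_or_gt_of_ne hs with h1 | h1
        · simp [Set.indicator, h1.not_gt, h1.not_ge]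
        · by_cases h2 : r ≤ s <;> simp [Set.indicator, h1, h2, h1.le]
    _ = _ := (calderon_eq_lintegral_max hg ht).symm

/-- On (s, m] the function is at most `g s`, which is at most its average over (0, s]. -/
theorem average_anti {g : ℝ → ℝ≥0∞} (hg : Antitone g) {s m : ℝ} (hs : 0 < s) (hsm : s ≤ m) :
    (∫⁻ r in Set.Ioc 0 m, g r) / ENNReal.ofReal m ≤
      (∫⁻ r in Set.Ioc 0 s, g r) / ENNReal.ofReal s := by
  have hm : 0 < m := hs.trans_le hsm
  have h1 : ∫⁻ r in Set.Ioc s m, g r ≤ g s * ENNReal.ofReal (m - s) := by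
    calc ∫⁻ r in Set.Ioc s m, g r ≤ ∫⁻ _ in Set.Ioc s m, g s :=
          setLIntegral_mono' measurableSet_Ioc fun r hr => hg hr.1.le
      _ = _ := by simp
  have h2 : g s ≤ (∫⁻ r in Set.Ioc 0 s, g r) / ENNReal.ofReal s := by
    rw [ENNReal.le_div_iff_mul_le (by simp [hs]) (by simp)]
    calc g s * ENNReal.ofReal s = ∫⁻ _ in Set.Ioc 0 s, g s := by simp
      _ ≤ _ := setLIntegral_mono' measurableSet_Ioc fun r hr => hg hr.2
  rw [ENNReal.div_le_iff (by simp [hm]) (by simp), ← Set.Ioc_union_Ioc_eq_Ioc hs.le hsm,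
    lintegral_union measurableSet_Ioc (Set.Ioc_disjoint_Ioc_of_le le_rfl)]
  calc _ ≤ (∫⁻ r in Set.Ioc 0 s, g r) / ENNReal.ofReal s * ENNReal.ofReal s +
        (∫⁻ r in Set.Ioc 0 s, g r) / ENNReal.ofReal s * ENNReal.ofReal (m - s) := by
        gcongr
        · rw [ENNReal.div_mul_cancel (by simp [hs]) (by simp)]
        · exact h1.trans (by gcongr)
    _ = _ := by
        rw [← mul_add, ← ENNReal.ofReal_add hs.le (by linarith)]
        congr 2
        ring

/-- Pointwise in s: t^(1/p)/max(s, t) ≤ max(s, t)^(1/p - 1) ≤ s^(1/p - 1), the last step because the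
exponent is nonpositive. -/
theorem rpow_mul_calderon_le {g : ℝ → ℝ≥0∞} (hg : Measurable g) {t p : ℝ} (ht : 0 < t)
    (hp : 1 ≤ p) :
    ENNReal.ofReal (t ^ (1 / p)) * calderon g t ≤
      ∫⁻ s in Set.Ioi (0 : ℝ), ENNReal.ofReal (s ^ (1 / p - 1)) * g s := by
  have hp0 : 0 ≤ 1 / p := by positivity
  have hp1 : 1 / p - 1 ≤ 0 := by
    rw [sub_nonpos, div_le_one (by linarith)]
    exact hp
  rw [calderon_eq_lintegral_max hg ht, ← lintegral_const_mul _ (by fun_prop)]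
  refine setLIntegral_mono' measurableSet_Ioi fun s hs => ?_
  have hs0 : 0 < s := hs
  have hmax : 0 < max s t := lt_max_of_lt_right ht
  rw [mul_comm (g s), ← mul_assoc, ← ENNReal.ofReal_inv_of_pos hmax,
    ← ENNReal.ofReal_mul (by positivity)]
  gcongr
  calc t ^ (1 / p) * (max s t)⁻¹ ≤ (max s t) ^ (1 / p) * (max s t)⁻¹ := by
        gcongr
        exact le_max_right _ _
    _ = (max s t) ^ (1 / p - 1) := by rw [Real.rpow_sub_one hmax.ne', ← div_eq_mul_inv]
    _ ≤ s ^ (1 / p - 1) := Real.rpow_le_rpow_of_nonpos hs0 (le_max_left _ _) hp1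

/-! ### Nested families and their maximal function -/

/-- A finite family of measurable sets of positive finite measure, any two of which are disjoint
or nested. -/
structure IsNestedFamily (μ : Measure X) (S : Finset (Set X)) : Prop where
  measurableSet : ∀ Q ∈ S, MeasurableSet Q
  measure_ne_zero : ∀ Q ∈ S, μ Q ≠ 0
  measure_ne_top : ∀ Q ∈ S, μ Q ≠ ∞
  nested : ∀ Q ∈ S, ∀ R ∈ S, Disjoint Q R ∨ Q ⊆ R ∨ R ⊆ Q

theorem IsNestedFamily.subset {S T : Finset (Set X)} (hS : IsNestedFamily μ S) (hTS : T ⊆ S) :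
    IsNestedFamily μ T where
  measurableSet Q hQ := hS.measurableSet Q (hTS hQ)
  measure_ne_zero Q hQ := hS.measure_ne_zero Q (hTS hQ)
  measure_ne_top Q hQ := hS.measure_ne_top Q (hTS hQ)
  nested Q hQ R hR := hS.nested Q (hTS hQ) R (hTS hR)

theorem measurableSet_biUnion_family {S : Finset (Set X)} (hS : ∀ Q ∈ S, MeasurableSet Q) :
    MeasurableSet (⋃ Q ∈ S, Q) :=
  S.measurableSet_biUnion hS

/-- Weak type estimate for a nested family: only the maximal members matter. -/
theorem IsNestedFamily.mul_measure_biUnion_le {φ : X → ℝ≥0∞} {a : ℝ≥0∞} (S : Finset (Set X))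
    (hS : IsNestedFamily μ S) (h : ∀ Q ∈ S, a * μ Q ≤ ∫⁻ x in Q, φ x ∂μ) :
    a * μ (⋃ Q ∈ S, Q) ≤ ∫⁻ x in ⋃ Q ∈ S, Q, φ x ∂μ := by
  classical
  induction S using Finset.strongInduction with
  | H S ih =>
    rcases S.eq_empty_or_nonempty with rfl | hne
    · simp
    obtain ⟨Q, hQ⟩ := S.exists_maximal hne
    -- By maximality of `Q`, every member meeting `Q` lies inside it, so the union splits as `Q` and
    -- the union of `T`, and the induction runs on `T`.
    set T := S.filter fun R => Disjoint Q R with hT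
    have hTS : T ⊆ S := Finset.filter_subset _ _
    have hQT : Q ∉ T := by
      intro hQT
      have := (Finset.mem_filter.1 hQT).2
      rw [disjoint_self] at this
      exact hS.measure_ne_zero Q hQ.prop (by rw [this]; exact measure_empty)
    have hunion : ⋃ R ∈ S, R = Q ∪ ⋃ R ∈ T, R := by
      refine Set.Subset.antisymm (Set.iUnion₂_subset fun R hR => ?_)
        (Set.union_subset (Set.subset_biUnion_of_mem (u := fun R => R) hQ.prop)
          (Set.biUnion_subset_biUnion_left fun R hR => hTS hR))
      rcases hS.nested Q hQ.prop R hR with hd | hs | hs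
      · exact (Set.subset_biUnion_of_mem (u := fun R => R)
          (show R ∈ (T : Set (Set X)) from by simp [hT, hR, hd])).trans Set.subset_union_right
      · exact (hQ.le_of_ge hR hs).trans Set.subset_union_left
      · exact hs.trans Set.subset_union_left
    have hdisj : Disjoint Q (⋃ R ∈ T, R) := by
      rw [Set.disjoint_iUnion₂_right]
      exact fun R hR => (Finset.mem_filter.1 hR).2
    have hTm : MeasurableSet (⋃ R ∈ T, R) :=
      measurableSet_biUnion_family (hS.subset hTS).measurableSet
    rw [hunion, measure_union hdisj hTm, lintegral_union hTm hdisj, mul_add]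
    exact add_le_add (h Q hQ.prop) (ih T (Finset.ssubset_iff_subset_ne.2
      ⟨hTS, fun hEq => hQT (hEq ▸ hQ.prop)⟩) (hS.subset hTS) fun R hR => h R (hTS hR))

/-- The maximal function of a finite family of sets. -/
noncomputable def familyMaximal (μ : Measure X) (S : Finset (Set X)) (φ : X → ℝ≥0∞) (x : X) :
    ℝ≥0∞ :=
  ⨆ Q ∈ S, Q.indicator (fun _ => ⨍⁻ y in Q, φ y ∂μ) x

/-- The positive sparse operator of a finite family of sets. -/
noncomputable def familySparse (μ : Measure X) (S : Finset (Set X)) (φ : X → ℝ≥0∞) (x : X) :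
    ℝ≥0∞ :=
  ∑ Q ∈ S, Q.indicator (fun _ => ⨍⁻ y in Q, φ y ∂μ) x

theorem measurable_familyMaximal {S : Finset (Set X)} (hS : ∀ Q ∈ S, MeasurableSet Q)
    (φ : X → ℝ≥0∞) : Measurable (familyMaximal μ S φ) :=
  Measurable.biSup _ S.countable_toSet fun Q hQ => measurable_const.indicator (hS Q hQ)

theorem measurable_familySparse {S : Finset (Set X)} (hS : ∀ Q ∈ S, MeasurableSet Q)
    (φ : X → ℝ≥0∞) : Measurable (familySparse μ S φ) :=
  Finset.measurable_fun_sum S fun Q hQ => measurable_const.indicator (hS Q hQ)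

theorem laverage_le_familyMaximal {S : Finset (Set X)} {Q : Set X} (hQ : Q ∈ S)
    (φ : X → ℝ≥0∞) {x : X} (hx : x ∈ Q) :
    ⨍⁻ y in Q, φ y ∂μ ≤ familyMaximal μ S φ x := by
  refine le_iSup₂_of_le Q hQ ?_
  rw [Set.indicator_of_mem hx]

theorem setOf_lt_familyMaximal (S : Finset (Set X)) (φ : X → ℝ≥0∞) (a : ℝ≥0∞)
    [DecidablePred fun Q => a < ⨍⁻ y in Q, φ y ∂μ] :
    {x | a < familyMaximal μ S φ x} = ⋃ Q ∈ S.filter fun Q => a < ⨍⁻ y in Q, φ y ∂μ, Q := by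
  ext x
  simp only [familyMaximal, Set.mem_ofPred_eq, lt_iSup_iff, Set.mem_iUnion, Finset.mem_filter,
    exists_prop]
  refine exists_congr fun Q => ?_
  by_cases hx : x ∈ Q <;> simp [hx]

/-- The level set is the union of the members with average above `a`. Keeping the integral over the
level set itself, not the whole space, is what allows non-integrable φ. -/
theorem IsNestedFamily.mul_measure_familyMaximal_le {S : Finset (Set X)} (hS : IsNestedFamily μ S)
    (φ : X → ℝ≥0∞) (a : ℝ≥0∞) :
    a * μ {x | a < familyMaximal μ S φ x} ≤ ∫⁻ x in {x | a < familyMaximal μ S φ x}, φ x ∂μ := by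
  classical
  rw [setOf_lt_familyMaximal]
  refine (hS.subset (Finset.filter_subset _ _)).mul_measure_biUnion_le _ fun Q hQ => ?_
  obtain ⟨hQS, hQa⟩ := Finset.mem_filter.1 hQ
  rw [setLAverage_eq] at hQa
  exact (ENNReal.le_div_iff_mul_le (Or.inl (hS.measure_ne_zero Q hQS))
    (Or.inl (hS.measure_ne_top Q hQS))).1 hQa.le

theorem IsNestedFamily.measure_familyMaximal_ne_top {S : Finset (Set X)}
    (hS : IsNestedFamily μ S) (φ : X → ℝ≥0∞) (a : ℝ≥0∞) :
    μ {x | a < familyMaximal μ S φ x} ≠ ∞ := by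
  classical
  rw [setOf_lt_familyMaximal]
  refine (lt_of_le_of_lt (measure_biUnion_finset_le _ _) ?_).ne
  exact ENNReal.sum_lt_top.2 fun Q hQ =>
    (hS.measure_ne_top Q (Finset.mem_filter.1 hQ).1).lt_top

/-- The rearrangement of the maximal function is at most the average of the rearrangement. -/
theorem IsNestedFamily.decRearr_familyMaximal_le [SFinite μ] {S : Finset (Set X)}
    (hS : IsNestedFamily μ S) {φ : X → ℝ≥0∞} (hφ : Measurable φ) {s : ℝ} (hs : 0 < s) :
    decRearr μ (familyMaximal μ S φ) s ≤
      (∫⁻ r in Set.Ioc 0 s, decRearr μ φ r) / ENNReal.ofReal s := by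
  refine le_of_forall_lt_imp_le_of_dense fun a ha => ?_
  rw [lt_decRearr_iff] at ha
  have hfin := hS.measure_familyMaximal_ne_top φ a
  have hm := (ENNReal.ofReal_lt_iff_lt_toReal hs.le hfin).1 ha
  -- The weak type bound gives the average over (0, m) with m the measure of the level set; since s
  -- < m, the average over (0, s) is larger.
  refine le_trans ?_ (average_anti (decRearr_antitone μ φ) hs hm.le)
  rw [ENNReal.le_div_iff_mul_le (by simp [hs.trans hm]) (by simp), ENNReal.ofReal_toReal hfin]
  exact (hS.mul_measure_familyMaximal_le φ a).trans (setLIntegral_le_lintegral_decRearr hφ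
    (measurableSet_lt measurable_const (measurable_familyMaximal hS.measurableSet φ))
    (ENNReal.ofReal_toReal hfin).ge)

/-! ### The sparse estimate for finite families -/

theorem familyMaximal_indicator_one_le {S : Finset (Set X)} {F : Set X} (x : X) :
    familyMaximal μ S (F.indicator fun _ => 1) x ≤ 1 := by
  refine iSup₂_le fun Q _ => Set.indicator_apply_le' (fun _ => ?_) (fun _ => zero_le)
  rw [setLAverage_eq]
  refine ENNReal.div_le_of_le_mul ?_
  calc ∫⁻ y in Q, F.indicator (fun _ => 1) y ∂μ ≤ ∫⁻ _ in Q, 1 ∂μ :=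
        lintegral_mono (Set.indicator_le_self' (by simp))
    _ = _ := by simp

theorem IsNestedFamily.decRearr_familyMaximal_indicator_le {S : Finset (Set X)}
    (hS : IsNestedFamily μ S) {F : Set X} (hF : MeasurableSet F) {s : ℝ} (hs : 0 < s) :
    decRearr μ (familyMaximal μ S (F.indicator fun _ => 1)) s ≤ μ F / ENNReal.ofReal s := by
  refine le_of_forall_lt_imp_le_of_dense fun a ha => ?_
  rw [lt_decRearr_iff] at ha
  rw [ENNReal.le_div_iff_mul_le (by simp [hs]) (by simp)]
  calc a * ENNReal.ofReal s ≤ a * μ {x | a < familyMaximal μ S (F.indicator fun _ => 1) x} := by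
        gcongr
    _ ≤ _ := hS.mul_measure_familyMaximal_le _ a
    _ ≤ ∫⁻ x, F.indicator (fun _ => 1) x ∂μ := setLIntegral_le_lintegral _ _
    _ = μ F := lintegral_indicator_one hF

/-- After Hardy-Littlewood, the bounds α and 1 are used on (0, τ]. Beyond τ, the average of φ* and
τ/s are used, and `lintegral_Ioi_average_div` evaluates the tail. -/
theorem lintegral_min_familyMaximal_mul_le [SFinite μ] {S : Finset (Set X)}
    (hS : IsNestedFamily μ S) {φ : X → ℝ≥0∞} (hφ : Measurable φ) {F : Set X}
    (hF : MeasurableSet F) {τ : ℝ} (hτ : 0 < τ) (hFτ : μ F = ENNReal.ofReal τ) (α : ℝ≥0∞) :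
    ∫⁻ x, min (familyMaximal μ S φ x) α * familyMaximal μ S (F.indicator fun _ => 1) x ∂μ ≤
      (α + calderon (decRearr μ φ) τ) * ENNReal.ofReal τ := by
  have hM : Measurable (familyMaximal μ S φ) := measurable_familyMaximal hS.measurableSet φ
  have hg := measurable_decRearr μ φ
  refine (lintegral_mul_le_lintegral_decRearr (hM.min measurable_const)
    (measurable_familyMaximal hS.measurableSet _)).trans ?_
  rw [← Set.Ioc_union_Ioi_eq_Ioi hτ.le, lintegral_union measurableSet_Ioi Set.Ioc_disjoint_Ioi_same,
    add_mul]
  gcongr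
  · calc _ ≤ ∫⁻ _ in Set.Ioc 0 τ, α := by
          refine lintegral_mono fun s => ?_
          exact (mul_le_mul' (decRearr_le_of_le (fun x => min_le_right _ _) s)
            (decRearr_le_of_le familyMaximal_indicator_one_le s)).trans_eq (mul_one α)
      _ = _ := by simp
  · calc _ ≤ ∫⁻ s in Set.Ioi τ, (∫⁻ r in Set.Ioc 0 s, decRearr μ φ r) / ENNReal.ofReal s /
            ENNReal.ofReal s * ENNReal.ofReal τ := by
          refine setLIntegral_mono' measurableSet_Ioi fun s hs => ?_
          have hs0 : 0 < s := hτ.trans hs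
          refine (mul_le_mul' ((decRearr_mono (fun x => min_le_left _ _) s).trans
            (hS.decRearr_familyMaximal_le hφ hs0))
            (hS.decRearr_familyMaximal_indicator_le hF hs0)).trans_eq ?_
          rw [hFτ]
          simp only [div_eq_mul_inv]
          ring
      _ = _ := by rw [lintegral_mul_const' _ _ ENNReal.ofReal_ne_top,
            lintegral_Ioi_average_div hg hτ]

/-- Each term is a product of the averages of φ and 1_F over `Q`, times |Q|. Sparseness moves it to
`E Q`, where both averages are below the maximal functions, and disjointness sums the pieces. -/
theorem setLIntegral_familySparse_le {S : Finset (Set X)} (hS : IsNestedFamily μ S) {c : ℝ≥0∞}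
    {E : Set X → Set X} (hE : ∀ Q ∈ S, MeasurableSet (E Q) ∧ E Q ⊆ Q ∧ c * μ Q ≤ μ (E Q))
    (hd : (S : Set (Set X)).PairwiseDisjoint E) (φ : X → ℝ≥0∞) {F : Set X}
    (hF : MeasurableSet F) (α : ℝ≥0∞) :
    c * ∫⁻ x in F \ {x | α < familyMaximal μ S φ x}, familySparse μ S φ x ∂μ ≤
      ∫⁻ x, min (familyMaximal μ S φ x) α * familyMaximal μ S (F.indicator fun _ => 1) x ∂μ := by
  set G := F \ {x | α < familyMaximal μ S φ x} with hG
  have hterm : ∀ Q ∈ S, c * ∫⁻ x in G, Q.indicator (fun _ => ⨍⁻ y in Q, φ y ∂μ) x ∂μ ≤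
      ∫⁻ x in E Q, min (familyMaximal μ S φ x) α *
        familyMaximal μ S (F.indicator fun _ => 1) x ∂μ := by
    intro Q hQ
    have hQm := hS.measurableSet Q hQ
    rw [lintegral_indicator hQm, setLIntegral_const, Measure.restrict_apply hQm]
    by_cases hα : ⨍⁻ y in Q, φ y ∂μ ≤ α
    · have hb : μ (Q ∩ F) = (⨍⁻ y in Q, F.indicator (fun _ => 1) y ∂μ) * μ Q := by
        rw [setLAverage_eq, ENNReal.div_mul_cancel (hS.measure_ne_zero Q hQ)
          (hS.measure_ne_top Q hQ)]
        rw [← Pi.one_def, lintegral_indicator_one hF, Measure.restrict_apply hF, Set.inter_comm]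
      calc c * ((⨍⁻ y in Q, φ y ∂μ) * μ (Q ∩ G))
          ≤ c * ((⨍⁻ y in Q, φ y ∂μ) * μ (Q ∩ F)) := by
            gcongr
            exact Set.sdiff_subset
        _ = (⨍⁻ y in Q, φ y ∂μ) * (⨍⁻ y in Q, F.indicator (fun _ => 1) y ∂μ) * (c * μ Q) := by
            rw [hb]
            ring
        _ ≤ (⨍⁻ y in Q, φ y ∂μ) * (⨍⁻ y in Q, F.indicator (fun _ => 1) y ∂μ) * μ (E Q) := by
            gcongr
            exact (hE Q hQ).2.2
        _ = ∫⁻ _ in E Q, (⨍⁻ y in Q, φ y ∂μ) * (⨍⁻ y in Q, F.indicator (fun _ => 1) y ∂μ) ∂μ :=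
            (setLIntegral_const _ _).symm
        _ ≤ _ := by
            refine setLIntegral_mono' (hE Q hQ).1 fun x hx => ?_
            have hxQ := (hE Q hQ).2.1 hx
            exact mul_le_mul' (le_min (laverage_le_familyMaximal hQ φ hxQ) hα)
              (laverage_le_familyMaximal hQ _ hxQ)
    -- A set of average above α lies in the removed level set, so its term vanishes on `G`.
    · have : Q ∩ G = ∅ := by
        ext x
        simp only [Set.mem_inter_iff, Set.mem_empty_iff_false, iff_false, not_and]
        exact fun hxQ hxG => hxG.2 ((not_le.1 hα).trans_le (laverage_le_familyMaximal hQ φ hxQ))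
      simp [this]
  simp only [familySparse]
  rw [lintegral_finsetSum' _ fun Q hQ =>
    (measurable_const.indicator (hS.measurableSet Q hQ)).aemeasurable, Finset.mul_sum]
  refine (Finset.sum_le_sum hterm).trans ?_
  rw [← lintegral_biUnion_finset hd fun Q hQ => (hE Q hQ).1]
  exact setLIntegral_le_lintegral _ _

/-- The rearrangement estimate for the positive sparse operator of a finite family. -/
theorem IsNestedFamily.decRearr_familySparse_le [SFinite μ] {S : Finset (Set X)}
    (hS : IsNestedFamily μ S) {η : ℝ} (hη : 0 < η) {E : Set X → Set X}
    (hE : ∀ Q ∈ S, MeasurableSet (E Q) ∧ E Q ⊆ Q ∧ ENNReal.ofReal η * μ Q ≤ μ (E Q))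
    (hd : (S : Set (Set X)).PairwiseDisjoint E) {φ : X → ℝ≥0∞} (hφ : Measurable φ)
    {t : ℝ} (ht : 0 < t) :
    decRearr μ (familySparse μ S φ) t ≤
      ENNReal.ofReal (6 / η) * calderon (decRearr μ φ) t := by
  refine le_of_forall_lt_imp_le_of_dense fun l hl => ?_
  rw [lt_decRearr_iff] at hl
  set F := {x | l < familySparse μ S φ x} with hFdef
  have hFm : MeasurableSet F :=
    measurableSet_lt measurable_const (measurable_familySparse hS.measurableSet φ)
  have hFtop : μ F ≠ ∞ := by
    have hsub : F ⊆ ⋃ Q ∈ S, Q := by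
      intro x hx
      by_contra hxS
      simp only [Set.mem_iUnion, not_exists] at hxS
      have h0 : familySparse μ S φ x = 0 :=
        Finset.sum_eq_zero fun Q hQ => Set.indicator_of_notMem (hxS Q hQ) _
      have hx' : l < familySparse μ S φ x := hx
      simp [h0] at hx'
    refine ((measure_mono hsub).trans (measure_biUnion_finset_le _ _)).trans_lt ?_ |>.ne
    exact ENNReal.sum_lt_top.2 fun Q hQ => (hS.measure_ne_top Q hQ).lt_top
  have htτ := (ENNReal.ofReal_lt_iff_lt_toReal ht.le hFtop).1 hl
  set τ := (μ F).toReal with hτdef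
  have hτ : 0 < τ := ht.trans htτ
  have hFτ : μ F = ENNReal.ofReal τ := (ENNReal.ofReal_toReal hFtop).symm
  -- As τ > t, the bound at τ is the stronger one.
  refine le_trans ?_ (mul_le_mul_right (calderon_anti (measurable_decRearr μ φ) ht htτ.le) _)
  set A := calderon (decRearr μ φ) τ with hA
  -- The average of φ* over (0, τ/2) is at most twice that over (0, τ), hence at most 2A.
  have hΩ : μ {x | 2 * A < familyMaximal μ S φ x} ≤ ENNReal.ofReal (τ / 2) := by
    rw [← not_lt, ← lt_decRearr_iff, not_lt]
    refine (hS.decRearr_familyMaximal_le hφ (half_pos hτ)).trans ?_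
    rw [ENNReal.ofReal_div_of_pos two_pos, ENNReal.ofReal_ofNat, div_eq_mul_inv,
      ENNReal.inv_div (by simp) (by simp), ← mul_div_assoc, mul_comm, mul_div_assoc]
    gcongr
    rw [hA, calderon]
    refine le_add_right ?_
    gcongr
    linarith
  have hhalf : ENNReal.ofReal (τ / 2) ≤ μ (F \ {x | 2 * A < familyMaximal μ S φ x}) := by
    refine le_trans ?_ le_measure_sdiff
    rw [hFτ]
    refine le_trans ?_ (tsub_le_tsub_left hΩ _)
    rw [← ENNReal.ofReal_sub _ (half_pos hτ).le]
    exact (congrArg _ (by ring)).le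
  have hkey : ENNReal.ofReal η * (l * ENNReal.ofReal (τ / 2)) ≤
      (2 * A + A) * ENNReal.ofReal τ := by
    refine le_trans ?_ ((setLIntegral_familySparse_le hS hE hd φ hFm (2 * A)).trans
      (lintegral_min_familyMaximal_mul_le hS hφ hFm hτ hFτ (2 * A)))
    gcongr
    calc l * ENNReal.ofReal (τ / 2) ≤ l * μ (F \ {x | 2 * A < familyMaximal μ S φ x}) := by gcongr
      _ = ∫⁻ _ in F \ {x | 2 * A < familyMaximal μ S φ x}, l ∂μ := (setLIntegral_const _ _).symm
      _ ≤ _ := setLIntegral_mono' (hFm.diff (measurableSet_lt measurable_const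
          (measurable_familyMaximal hS.measurableSet φ))) fun x hx => le_of_lt hx.1
  have hc0 : ENNReal.ofReal (η * (τ / 2)) ≠ 0 := by
    simp only [ne_eq, ENNReal.ofReal_eq_zero, not_le]
    positivity
  rw [← ENNReal.mul_le_mul_iff_right hc0 ENNReal.ofReal_ne_top]
  calc ENNReal.ofReal (η * (τ / 2)) * l = ENNReal.ofReal η * (l * ENNReal.ofReal (τ / 2)) := by
        rw [ENNReal.ofReal_mul hη.le]
        ring
    _ ≤ (2 * A + A) * ENNReal.ofReal τ := hkey
    _ = ENNReal.ofReal (3 * τ) * A := by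
        rw [ENNReal.ofReal_mul (by norm_num), ENNReal.ofReal_ofNat]
        ring
    _ = ENNReal.ofReal (η * (τ / 2)) * (ENNReal.ofReal (6 / η) * A) := by
        rw [← mul_assoc, ← ENNReal.ofReal_mul (by positivity)]
        congr 2
        field_simp
        norm_num

/-! ### Infinite families and almost everywhere finiteness -/

/-- The positive sparse operator of a family of sets, with values in `[0, ∞]`. -/
noncomputable def positiveSparse (μ : Measure X) (S : Set (Set X)) (φ : X → ℝ≥0∞) (x : X) :
    ℝ≥0∞ :=
  ∑' Q : S, (Q : Set X).indicator (fun _ => ⨍⁻ y in Q, φ y ∂μ) x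

/-- The rearrangement estimate for the positive sparse operator. -/
theorem decRearr_positiveSparse_le [SFinite μ] {S : Set (Set X)} (hSc : S.Countable)
    (hS : ∀ T : Finset (Set X), (T : Set (Set X)) ⊆ S → IsNestedFamily μ T) {η : ℝ} (hη : 0 < η)
    {E : Set X → Set X}
    (hE : ∀ Q ∈ S, MeasurableSet (E Q) ∧ E Q ⊆ Q ∧ ENNReal.ofReal η * μ Q ≤ μ (E Q))
    (hd : S.PairwiseDisjoint E) {φ : X → ℝ≥0∞} (hφ : AEMeasurable φ μ) {t : ℝ} (ht : 0 < t) :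
    decRearr μ (positiveSparse μ S φ) t ≤
      ENNReal.ofReal (6 / η) * calderon (decRearr μ φ) t := by
  have : Countable S := hSc.to_subtype
  have hg : decRearr μ φ = decRearr μ (hφ.mk φ) :=
    funext fun s => decRearr_congr_ae hφ.ae_eq_mk s
  have hav : positiveSparse μ S φ = positiveSparse μ S (hφ.mk φ) := by
    refine funext fun x => tsum_congr fun Q => ?_
    rw [laverage_congr (ae_restrict_of_ae hφ.ae_eq_mk)]
  rw [hg, hav]
  refine le_of_forall_lt fun l hl => ?_
  rw [lt_decRearr_iff] at hl
  have hsum : ∀ x, positiveSparse μ S (hφ.mk φ) x = ⨆ T : Finset S,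
      familySparse μ (T.map (Function.Embedding.subtype _)) (hφ.mk φ) x := by
    intro x
    simp only [positiveSparse, familySparse, Finset.sum_map, ENNReal.tsum_eq_iSup_sum]
    rfl
  have hmono : Monotone fun T : Finset S =>
      {x | l < familySparse μ (T.map (Function.Embedding.subtype _)) (hφ.mk φ) x} := by
    intro T U hTU x hx
    have hx' : l < familySparse μ (T.map (Function.Embedding.subtype _)) (hφ.mk φ) x := hx
    refine lt_of_lt_of_le hx' (Finset.sum_le_sum_of_subset ?_)
    exact Finset.map_subset_map.2 hTU
  have hset : {x | l < positiveSparse μ S (hφ.mk φ) x} = ⋃ T : Finset S,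
      {x | l < familySparse μ (T.map (Function.Embedding.subtype _)) (hφ.mk φ) x} := by
    ext x
    simp [hsum, lt_iSup_iff]
  -- Continuity of measure along the directed union: some finite subfamily already has a level set
  -- of measure above t.
  rw [hset, hmono.directed_le.measure_iUnion, lt_iSup_iff] at hl
  obtain ⟨T, hT⟩ := hl
  have hTS : ((T.map (Function.Embedding.subtype _) : Finset (Set X)) : Set (Set X)) ⊆ S := by
    intro Q hQ
    simp only [Finset.coe_map, Set.mem_image] at hQ
    obtain ⟨R, -, rfl⟩ := hQ
    exact R.2
  exact (lt_decRearr_iff.2 hT).trans_le ((hS _ hTS).decRearr_familySparse_le hη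
    (fun Q hQ => hE Q (hTS hQ)) (hd.subset hTS) hφ.measurable_mk ht)

/-- The kernels satisfy max(s, u) ≤ (u/t)·max(s, t). Thus finiteness at one point gives finiteness
at every smaller one. -/
theorem calderon_le_mul_calderon {g : ℝ → ℝ≥0∞} (hg : Measurable g) {t u : ℝ} (ht : 0 < t)
    (htu : t ≤ u) : calderon g t ≤ ENNReal.ofReal (u / t) * calderon g u := by
  have hu : 0 < u := ht.trans_le htu
  rw [calderon_eq_lintegral_max hg ht, calderon_eq_lintegral_max hg hu,
    ← lintegral_const_mul _ (by fun_prop)]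
  refine setLIntegral_mono' measurableSet_Ioi fun s hs => ?_
  have hst : 0 < max s t := lt_max_of_lt_right ht
  have hsu : 0 < max s u := lt_max_of_lt_right hu
  rw [mul_left_comm, ← ENNReal.ofReal_inv_of_pos hst, ← ENNReal.ofReal_inv_of_pos hsu,
    ← ENNReal.ofReal_mul (by positivity)]
  gcongr
  rw [← div_eq_mul_inv, div_div, inv_eq_one_div, div_le_div_iff₀ hst (by positivity), one_mul]
  rcases le_total s u with h | h
  · rw [max_eq_right h, mul_comm]
    gcongr
    exact le_max_right _ _
  · rw [max_eq_left h, max_eq_left (htu.trans h)]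
    have : 0 < s := hs
    gcongr

/-- A function whose rearrangement is finite near `0` is finite almost everywhere. -/
theorem ae_lt_top_of_decRearr_lt_top {φ : X → ℝ≥0∞} {t : ℝ} (ht : 0 < t)
    (h : ∀ s, 0 < s → s ≤ t → decRearr μ φ s < ∞) : ∀ᵐ x ∂μ, φ x < ∞ := by
  rw [ae_iff]
  refine le_antisymm (le_of_forall_gt_imp_ge_of_dense fun ε hε => ?_) zero_le
  obtain ⟨s, hs0, hst, hsε⟩ : ∃ s : ℝ, 0 < s ∧ s ≤ t ∧ ENNReal.ofReal s ≤ ε := by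
    rcases eq_or_ne ε ∞ with rfl | hε'
    · exact ⟨t, ht, le_rfl, le_top⟩
    · exact ⟨min t ε.toReal, lt_min ht (ENNReal.toReal_pos hε.ne' hε'), min_le_left _ _,
        ENNReal.ofReal_le_of_le_toReal (min_le_right _ _)⟩
  -- The set where φ is infinite lies in {φ > φ*(s)}, of measure at most s.
  refine le_trans (measure_mono fun x hx => ?_)
    ((not_lt.1 (lt_decRearr_iff.not.1 (lt_irrefl (decRearr μ φ s)))).trans hsε)
  have hx' : φ x = ∞ := not_lt_top_iff.1 hx
  change decRearr μ φ s < φ x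
  rw [hx']
  exact h s hs0 hst

/-- A set of positive measure contains a point where the sum is finite, and the average over `Q` is
one of its terms there. -/
theorem lintegral_lt_top_of_ae_positiveSparse_lt_top {S : Set (Set X)} {φ : X → ℝ≥0∞}
    (h : ∀ᵐ x ∂μ, positiveSparse μ S φ x < ∞) {Q : Set X} (hQ : Q ∈ S) (h0 : μ Q ≠ 0)
    (htop : μ Q ≠ ∞) : ∫⁻ x in Q, φ x ∂μ < ∞ := by
  obtain ⟨x, hxQ, hx⟩ : ∃ x ∈ Q, positiveSparse μ S φ x < ∞ := by
    by_contra! hcon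
    refine h0 (measure_mono_null (fun x hx => ?_) (ae_iff.1 h))
    exact not_lt.2 (hcon x hx)
  have hle : ⨍⁻ y in Q, φ y ∂μ ≤ positiveSparse μ S φ x := by
    have := ENNReal.le_tsum (f := fun Q : S =>
      (Q : Set X).indicator (fun _ => ⨍⁻ y in Q, φ y ∂μ) x) ⟨Q, hQ⟩
    rwa [Set.indicator_of_mem hxQ] at this
  have hlt := hle.trans_lt hx
  rw [setLAverage_eq, ENNReal.div_lt_iff (Or.inl h0) (Or.inl htop)] at hlt
  exact hlt.trans_le le_top

theorem countable_of_pairwiseDisjoint_of_measure_pos [SFinite μ] {S : Set (Set X)}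
    {E : Set X → Set X} (hE : ∀ Q ∈ S, MeasurableSet (E Q)) (hpos : ∀ Q ∈ S, 0 < μ (E Q))
    (hd : S.PairwiseDisjoint E) : S.Countable := by
  have h := Measure.countable_meas_pos_of_disjoint_iUnion (μ := μ) (As := fun Q : S => E Q)
    (fun Q => hE Q Q.2) (fun Q R hQR => hd Q.2 R.2 fun h => hQR (Subtype.ext h))
  have huniv : {Q : S | 0 < μ (E Q)} = Set.univ := Set.eq_univ_of_forall fun Q => hpos Q Q.2
  rw [huniv, Set.countable_univ_iff] at h
  exact Set.countable_coe_iff.1 h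

/-! ### Cubes, dyadic grids and the sparse operator of a signed or complex function -/

section Cubes

variable {n : ℕ} {𝕜 : Type*} [RCLike 𝕜]

theorem IsCube.measurableSet {l : ℝ} {Q : Set (Fin n → ℝ)} (hQ : IsCube l Q) :
    MeasurableSet Q := by
  obtain ⟨-, a, I, hI, rfl⟩ := hQ
  refine MeasurableSet.univ_pi fun i => ?_
  have hdiff : (I i \ Set.Ioo (a i) (a i + l)).Finite := by
    refine (Set.toFinite {a i, a i + l}).subset fun x hx => ?_
    obtain ⟨h1, h2⟩ := (hI i).2 hx.1
    by_contra hne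
    simp only [Set.mem_insert_iff, Set.mem_singleton_iff, not_or] at hne
    exact hx.2 ⟨lt_of_le_of_ne h1 (Ne.symm hne.1), lt_of_le_of_ne h2 hne.2⟩
  rw [← Set.sdiff_union_of_subset (hI i).1]
  exact hdiff.measurableSet.union measurableSet_Ioo

theorem IsCube.volume_ne_zero {l : ℝ} {Q : Set (Fin n → ℝ)} (hQ : IsCube l Q) :
    volume Q ≠ 0 := by
  obtain ⟨hl, a, I, hI, rfl⟩ := hQ
  have hopen : IsOpen (Set.univ.pi fun i => Set.Ioo (a i) (a i + l)) :=
    isOpen_set_pi Set.finite_univ fun i _ => isOpen_Ioo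
  have hne : (Set.univ.pi fun i => Set.Ioo (a i) (a i + l)).Nonempty :=
    Set.univ_pi_nonempty_iff.2 fun i => Set.nonempty_Ioo.2 (by linarith)
  exact ((hopen.measure_pos volume hne).trans_le
    (measure_mono (Set.pi_mono fun i _ => (hI i).1))).ne'

theorem IsCube.volume_ne_top {l : ℝ} {Q : Set (Fin n → ℝ)} (hQ : IsCube l Q) :
    volume Q ≠ ∞ := by
  obtain ⟨-, a, I, hI, rfl⟩ := hQ
  exact ((measure_mono (Set.pi_mono fun i _ => (hI i).2)).trans_lt
    (isCompact_univ_pi fun i => isCompact_Icc).measure_lt_top).ne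

theorem IsDyadicGrid.isNestedFamily {D : Set (Set (Fin n → ℝ))} (hD : IsDyadicGrid D)
    {T : Finset (Set (Fin n → ℝ))} (hT : (T : Set (Set (Fin n → ℝ))) ⊆ D) :
    IsNestedFamily volume T where
  measurableSet Q hQ := (hD.side Q (hT hQ)).choose_spec.measurableSet
  measure_ne_zero Q hQ := (hD.side Q (hT hQ)).choose_spec.volume_ne_zero
  measure_ne_top Q hQ := (hD.side Q (hT hQ)).choose_spec.volume_ne_top
  nested Q hQ R hR := hD.nested Q (hT hQ) R (hT hR)

theorem enorm_sparseTerm_le (f : (Fin n → ℝ) → 𝕜) (Q : Set (Fin n → ℝ)) (x : Fin n → ℝ) :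
    ‖sparseTerm f Q x‖ₑ ≤ Q.indicator (fun _ => ⨍⁻ y in Q, ‖f y‖ₑ ∂volume) x := by
  by_cases hx : x ∈ Q
  · simp only [sparseTerm, Set.indicator_of_mem hx]
    exact enorm_integral_le_lintegral_enorm _
  · simp [sparseTerm, hx]

theorem tsum_enorm_sparseTerm_le (S : Set (Set (Fin n → ℝ))) (f : (Fin n → ℝ) → 𝕜)
    (x : Fin n → ℝ) :
    ∑' Q : S, ‖sparseTerm f (Q : Set (Fin n → ℝ)) x‖ₑ ≤
      positiveSparse volume S (fun y => ‖f y‖ₑ) x :=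
  ENNReal.tsum_le_tsum fun Q => enorm_sparseTerm_le f Q x

theorem enorm_sparseOperator_le (S : Set (Set (Fin n → ℝ))) (f : (Fin n → ℝ) → 𝕜)
    (x : Fin n → ℝ) :
    ‖sparseOperator S f x‖ₑ ≤ positiveSparse volume S (fun y => ‖f y‖ₑ) x :=
  enorm_tsum_le_tsum_enorm.trans (tsum_enorm_sparseTerm_le S f x)

theorem summable_norm_sparseTerm {S : Set (Set (Fin n → ℝ))} {f : (Fin n → ℝ) → 𝕜}
    {x : Fin n → ℝ} (h : positiveSparse volume S (fun y => ‖f y‖ₑ) x < ∞) :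
    Summable fun Q : S => ‖sparseTerm f (Q : Set (Fin n → ℝ)) x‖ := by
  have hne := ((tsum_enorm_sparseTerm_le S f x).trans_lt h).ne
  simp only [enorm_eq_nnnorm] at hne
  exact NNReal.summable_coe.2 (ENNReal.tsum_coe_ne_top_iff_summable.1 hne)

/-- The pointwise rearrangement estimate implies the Lorentz space bound. -/
theorem weakNorm_le_mul_lorentzOneNorm {f h : (Fin n → ℝ) → 𝕜} {C : ℝ} (hC : 0 ≤ C)
    (hle : ∀ t : ℝ, 0 < t →
      rearrangement h t ≤ ENNReal.ofReal C * calderon (rearrangement f) t)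
    {p : ℝ} (hp : 1 ≤ p) :
    weakNorm p h ≤ ENNReal.ofReal (C * p) * lorentzOneNorm p f := by
  refine iSup₂_le fun t ht => ?_
  calc ENNReal.ofReal (t ^ (1 / p)) * rearrangement h t
      ≤ ENNReal.ofReal (t ^ (1 / p)) * (ENNReal.ofReal C * calderon (rearrangement f) t) := by
        gcongr
        exact hle t ht
    _ = ENNReal.ofReal C * (ENNReal.ofReal (t ^ (1 / p)) * calderon (rearrangement f) t) :=
        mul_left_comm _ _ _
    _ ≤ ENNReal.ofReal C * ∫⁻ s in Set.Ioi (0 : ℝ),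
          ENNReal.ofReal (s ^ (1 / p - 1)) * rearrangement f s := by
        gcongr
        exact rpow_mul_calderon_le (measurable_decRearr _ _) ht hp
    -- The factor p only undoes the normalization 1/p of the Lorentz norm.
    _ = ENNReal.ofReal (C * p) * lorentzOneNorm p f := by
        have hp0 : 0 < p := by linarith
        rw [lorentzOneNorm, ← mul_assoc, ← ENNReal.ofReal_mul (by positivity), mul_assoc,
          mul_one_div_cancel hp0.ne', mul_one]

end Cubes

end SparseOp

/-! ### The main theorem -/

theorem mainTheorem9 {𝕜 : Type*} [RCLike 𝕜] (n : ℕ) (hn : 1 ≤ n)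
    (η : ℝ) (hη0 : 0 < η) (hη1 : η < 1) :
    ∃ C : ℝ, 0 < C ∧
      ∀ (D S : Set (Set (Fin n → ℝ))), SparseOp.IsDyadicGrid D → S ⊆ D → SparseOp.IsSparse η S →
      ∀ f : (Fin n → ℝ) → 𝕜, AEMeasurable f volume →
        -- the series defining the sparse operator makes sense when the right-hand side is finite
        ((∃ t : ℝ, 0 < t ∧ SparseOp.calderon (SparseOp.rearrangement f) t < ∞) →
          (∀ Q ∈ S, IntegrableOn f Q volume) ∧
          ∀ᵐ x ∂(volume : Measure (Fin n → ℝ)),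
            Summable fun Q : S => ‖SparseOp.sparseTerm f (Q : Set (Fin n → ℝ)) x‖) ∧
        -- the pointwise estimate
        (∀ t : ℝ, 0 < t →
          SparseOp.rearrangement (SparseOp.sparseOperator S f) t ≤
            ENNReal.ofReal C * SparseOp.calderon (SparseOp.rearrangement f) t) ∧
        -- the Lorentz space bound, linear in `p`
        (∀ p : ℝ, 1 ≤ p →
          SparseOp.weakNorm p (SparseOp.sparseOperator S f) ≤
            ENNReal.ofReal (C * p) * SparseOp.lorentzOneNorm p f) := by
  refine ⟨6 / η, by positivity, fun D S hD hSD hsp f hf => ?_⟩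
  obtain ⟨E, hE, hd⟩ := hsp
  have hfam : ∀ T : Finset (Set (Fin n → ℝ)), (T : Set (Set (Fin n → ℝ))) ⊆ S →
      SparseOp.IsNestedFamily volume T := fun T hT => hD.isNestedFamily (hT.trans hSD)
  have hQ0 : ∀ Q ∈ S, volume Q ≠ 0 := fun Q hQ =>
    (hD.side Q (hSD hQ)).choose_spec.volume_ne_zero
  have hQtop : ∀ Q ∈ S, volume Q ≠ ∞ := fun Q hQ =>
    (hD.side Q (hSD hQ)).choose_spec.volume_ne_top
  have hSc : S.Countable := by
    refine SparseOp.countable_of_pairwiseDisjoint_of_measure_pos (μ := volume)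
      (fun Q hQ => (hE Q hQ).1) (fun Q hQ => lt_of_lt_of_le ?_ (hE Q hQ).2.2) hd
    exact ENNReal.mul_pos (by simpa using hη0) (hQ0 Q hQ)
  have hpos : ∀ t : ℝ, 0 < t →
      SparseOp.decRearr volume (SparseOp.positiveSparse volume S fun y => ‖f y‖ₑ) t ≤
        ENNReal.ofReal (6 / η) * SparseOp.calderon (SparseOp.rearrangement f) t := fun t ht =>
    -- `rearrangement f` is by definition `decRearr volume` of the extended norm of `f`.
    SparseOp.decRearr_positiveSparse_le hSc hfam hη0 hE hd hf.enorm ht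
  have hmain : ∀ t : ℝ, 0 < t →
      SparseOp.rearrangement (SparseOp.sparseOperator S f) t ≤
        ENNReal.ofReal (6 / η) * SparseOp.calderon (SparseOp.rearrangement f) t := fun t ht =>
    (SparseOp.decRearr_mono (SparseOp.enorm_sparseOperator_le S f) t).trans (hpos t ht)
  refine ⟨?_, hmain, fun p hp => SparseOp.weakNorm_le_mul_lorentzOneNorm (by positivity) hmain hp⟩
  rintro ⟨t, ht, hfin⟩
  have hae : ∀ᵐ x ∂(volume : Measure (Fin n → ℝ)),
      SparseOp.positiveSparse volume S (fun y => ‖f y‖ₑ) x < ∞ := by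
    refine SparseOp.ae_lt_top_of_decRearr_lt_top ht fun s hs hst => (hpos s hs).trans_lt ?_
    refine ENNReal.mul_lt_top ENNReal.ofReal_lt_top (lt_of_le_of_lt
      (SparseOp.calderon_le_mul_calderon (SparseOp.measurable_decRearr _ _) hs hst) ?_)
    exact ENNReal.mul_lt_top ENNReal.ofReal_lt_top hfin
  refine ⟨fun Q hQ => ⟨hf.aestronglyMeasurable.restrict, ?_⟩, ?_⟩
  · exact SparseOp.lintegral_lt_top_of_ae_positiveSparse_lt_top hae hQ (hQ0 Q hQ) (hQtop Q hQ)
  · filter_upwards [hae] with x hx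
    exact SparseOp.summable_norm_sparseTerm hx
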